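/- Let $n\ge 0$ and let $N=(N_1,\dots,N_n):\mathbb R^n\to\mathbb R^n$ be a polynomial map, $N_i\in\mathbb R[X_1,\dots,X_n]$, which is nilpotent, i.e. its Jacobian matrix $JN(X)=\left(\partial N_i/\partial X_j\right)_{1\le i,j\le n}$ is a nilpotent matrix over $\mathbb R[X_1,\dots,X_n]$. Call $N$ positive (resp. negative) if all non-zero coefficients of all the $N_i$ are positive (resp. negative). (1) If $N$ is positive, then $F=\mathrm{Id}+N:\mathbb R^n\to\mathbb R^n$ is invertible, i.e. it has a two-sided inverse map $\mathbb R^n\to\mathbb R^n$ which is also given by polynomials. (2) If $N$ is positive or negative, then $N$ has at most one fixed point, i.e. there is at most one $x\in\mathbb R^n$ with $N(x)=x$. -/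

import Mathlib

/-- Polynomial self-maps of `ℝⁿ`, given by their `n` coordinate polynomials. -/
abbrev RealPolyMap (n : ℕ) : Type := Fin n → MvPolynomial (Fin n) ℝ

namespace RealPolyMap

variable {n : ℕ}

/-- The map `ℝⁿ → ℝⁿ` defined by the coordinate polynomials. -/
noncomputable def toFun (F : RealPolyMap n) (x : Fin n → ℝ) : Fin n → ℝ :=
  fun i => MvPolynomial.eval x (F i)

/-- The identity map `(X₁, …, Xₙ)`. -/
noncomputable def idMap (n : ℕ) : RealPolyMap n := fun i => MvPolynomial.X i

/-- The Jacobian matrix `(∂Fᵢ/∂Xⱼ)`, with polynomial entries. -/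
noncomputable def jacobianMatrix (F : RealPolyMap n) :
    Matrix (Fin n) (Fin n) (MvPolynomial (Fin n) ℝ) :=
  Matrix.of fun i j => MvPolynomial.pderiv j (F i)

/-- A polynomial map is nilpotent if its Jacobian matrix is a nilpotent matrix over the
polynomial ring. -/
def IsNilpotentMap (N : RealPolyMap n) : Prop := IsNilpotent (jacobianMatrix N)

/-- All non-zero coefficients are positive. -/
def IsPositive (N : RealPolyMap n) : Prop :=
  ∀ (i : Fin n) (m : Fin n →₀ ℕ), (N i).coeff m ≠ 0 → 0 < (N i).coeff m

/-- All non-zero coefficients are negative. -/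
def IsNegative (N : RealPolyMap n) : Prop :=
  ∀ (i : Fin n) (m : Fin n →₀ ℕ), (N i).coeff m ≠ 0 → (N i).coeff m < 0

/-- The map has a two-sided inverse which is also given by polynomials. -/
def IsInvertible (F : RealPolyMap n) : Prop :=
  ∃ G : RealPolyMap n,
    Function.LeftInverse (toFun G) (toFun F) ∧ Function.RightInverse (toFun G) (toFun F)

/-- The map has at most one fixed point in `ℝⁿ`. -/
def HasAtMostOneFixedPoint (N : RealPolyMap n) : Prop :=
  (Function.fixedPoints (toFun N)).Subsingleton

end RealPolyMap

/-- A nilpotent matrix with nonnegative real entries is strictly triangular with respect to some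
height function on its indices. -/
theorem Matrix.exists_height_of_isNilpotent_of_nonneg {ι : Type*} [Fintype ι] [DecidableEq ι]
    (B : Matrix ι ι ℝ) (hB : ∀ i j, 0 ≤ B i j) (hnil : IsNilpotent B) :
    ∃ h : ι → ℕ, ∀ i j, B i j ≠ 0 → h j < h i := by
  obtain ⟨k, hk⟩ := hnil
  have hex : ∀ i, ∃ m, ((B ^ m).mulVec 1) i = 0 := fun i => ⟨k, by simp [hk]⟩
  have hnn : ∀ m i, 0 ≤ ((B ^ m).mulVec 1) i := by
    intro m
    induction m with
    | zero => intro i; simp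
    | succ m ih =>
      intro i
      rw [pow_succ', ← Matrix.mulVec_mulVec]
      exact Finset.sum_nonneg fun j _ => mul_nonneg (hB i j) (ih j)
  refine ⟨fun i => Nat.find (hex i), fun i j hij => ?_⟩
  have hs := Nat.find_spec (hex i)
  rcases hm : Nat.find (hex i) with _ | m
  · rw [hm] at hs
    simp at hs
  · rw [hm, pow_succ', ← Matrix.mulVec_mulVec] at hs
    have hz := (Finset.sum_eq_zero_iff_of_nonneg
      (fun j _ => mul_nonneg (hB i j) (hnn m j))).1 hs j (Finset.mem_univ j)
    change Nat.find (hex j) < Nat.find (hex i)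
    rw [hm]
    exact Nat.lt_succ_of_le (Nat.find_min' (hex j) ((mul_eq_zero.1 hz).resolve_left hij))

namespace MvPolynomial

theorem eval_one_eq_sum_coeff {σ : Type*} (p : MvPolynomial σ ℝ) :
    eval (fun _ => (1 : ℝ)) p = ∑ m ∈ p.support, p.coeff m := by
  simp [eval_eq]

theorem eval_one_nonneg {σ : Type*} {p : MvPolynomial σ ℝ} (hp : ∀ m, 0 ≤ p.coeff m) :
    0 ≤ eval (fun _ => (1 : ℝ)) p := by
  rw [eval_one_eq_sum_coeff]
  exact Finset.sum_nonneg fun m _ => hp m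

theorem eq_zero_of_eval_one_eq_zero {σ : Type*} {p : MvPolynomial σ ℝ}
    (hp : ∀ m, 0 ≤ p.coeff m) (h : eval (fun _ => (1 : ℝ)) p = 0) : p = 0 := by
  rw [eval_one_eq_sum_coeff, Finset.sum_eq_zero_iff_of_nonneg fun m _ => hp m] at h
  ext m
  by_cases hm : m ∈ p.support
  · simpa using h m hm
  · simpa using hm

theorem coeff_pderiv_nonneg {σ : Type*} {p : MvPolynomial σ ℝ}
    (hp : ∀ m, 0 ≤ p.coeff m) (j : σ) (m : σ →₀ ℕ) : 0 ≤ (pderiv j p).coeff m := by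
  rw [coeff_pderiv]
  exact mul_nonneg (hp _) (by positivity)

theorem pderiv_ne_zero_of_mem_vars {σ : Type*} {p : MvPolynomial σ ℝ} {j : σ}
    (hj : j ∈ p.vars) : pderiv j p ≠ 0 := by
  obtain ⟨m, hm, hjm⟩ := (mem_vars_iff_mem_support j).1 hj
  intro h
  have hle : Finsupp.single j 1 ≤ m := by
    rw [Finsupp.single_le_iff]
    exact Nat.one_le_iff_ne_zero.2 (Finsupp.mem_support_iff.1 hjm)
  have hc := congrArg (coeff (m - Finsupp.single j 1)) h
  rw [coeff_pderiv, tsub_add_cancel_of_le hle, coeff_zero] at hc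
  rcases mul_eq_zero.1 hc with hc | hc
  · exact mem_support_iff.1 hm hc
  · have : (0 : ℝ) ≤ ((m - Finsupp.single j 1 : σ →₀ ℕ) j : ℝ) := Nat.cast_nonneg _
    linarith

end MvPolynomial

namespace RealPolyMap

variable {n : ℕ}

/-- `N` is strictly triangular with respect to the height function `h`. -/
def IsTriangularFor (N : RealPolyMap n) (h : Fin n → ℕ) : Prop :=
  ∀ i, ∀ j ∈ (N i).vars, h j < h i

theorem IsPositive.coeff_nonneg {N : RealPolyMap n} (hN : N.IsPositive) (i : Fin n)
    (m : Fin n →₀ ℕ) : 0 ≤ (N i).coeff m := by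
  by_cases h : (N i).coeff m = 0
  · exact h.ge
  · exact (hN i m h).le

theorem IsNilpotentMap.exists_isTriangularFor {N : RealPolyMap n} (hnil : N.IsNilpotentMap)
    (hN : N.IsPositive) : ∃ h, N.IsTriangularFor h := by
  have hnn (i j : Fin n) := MvPolynomial.coeff_pderiv_nonneg (hN.coeff_nonneg i) j
  obtain ⟨h, hh⟩ := Matrix.exists_height_of_isNilpotent_of_nonneg
    ((MvPolynomial.eval fun _ : Fin n => (1 : ℝ)).mapMatrix N.jacobianMatrix)
    (fun i j => MvPolynomial.eval_one_nonneg (hnn i j)) (IsNilpotent.map hnil _)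
  exact ⟨h, fun i j hj => hh i j fun h0 => MvPolynomial.pderiv_ne_zero_of_mem_vars hj
    (MvPolynomial.eq_zero_of_eval_one_eq_zero (hnn i j) h0)⟩

theorem IsNilpotentMap.neg {N : RealPolyMap n} (hN : N.IsNilpotentMap) :
    (-N).IsNilpotentMap := by
  have h : jacobianMatrix (-N) = -jacobianMatrix N := by
    ext1 i j
    simp [jacobianMatrix]
  rw [IsNilpotentMap, h]
  exact IsNilpotent.neg hN

theorem IsNegative.neg {N : RealPolyMap n} (hN : N.IsNegative) : (-N).IsPositive := by
  intro i m h
  simp only [Pi.neg_apply, MvPolynomial.coeff_neg, ne_eq, neg_eq_zero] at h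
  simpa using hN i m h

namespace IsTriangularFor

variable {N : RealPolyMap n} {h : Fin n → ℕ}

theorem of_neg (hN : (-N).IsTriangularFor h) : N.IsTriangularFor h := by
  intro i j hj
  exact hN i j (by simpa [MvPolynomial.vars_neg] using hj)

theorem eq_of_toFun_eq_imp (hN : N.IsTriangularFor h) {x y : Fin n → ℝ}
    (hxy : ∀ i, toFun N x i = toFun N y i → x i = y i) : x = y := by
  suffices H : ∀ k i, h i < k → x i = y i from funext fun i => H _ i (Nat.lt_succ_self _)
  intro k
  induction k with
  | zero => intro i hi; omega
  | succ k ih =>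
    intro i hi
    refine hxy i (MvPolynomial.eval₂Hom_congr' rfl (fun j hj _ => ih j ?_) rfl)
    have := hN i j hj
    omega

theorem hasAtMostOneFixedPoint (hN : N.IsTriangularFor h) : N.HasAtMostOneFixedPoint := by
  intro x hx y hy
  refine hN.eq_of_toFun_eq_imp fun i hi => ?_
  rwa [hx.eq, hy.eq] at hi

theorem toFun_idMap_add (N : RealPolyMap n) (x : Fin n → ℝ) :
    toFun (idMap n + N) x = x + toFun N x := by
  ext i
  simp [toFun, idMap]

theorem injective_toFun_idMap_add (hN : N.IsTriangularFor h) :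
    Function.Injective (toFun (idMap n + N)) := by
  intro x y hxy
  refine hN.eq_of_toFun_eq_imp fun i hi => ?_
  have := congrFun hxy i
  simp only [toFun_idMap_add, Pi.add_apply] at this
  linarith

/-- Iterates of `G ↦ X - N(G)`, starting from the identity. -/
noncomputable def _root_.RealPolyMap.inverseApprox (N : RealPolyMap n) : ℕ → RealPolyMap n
  | 0 => idMap n
  | k + 1 => fun i => MvPolynomial.X i - MvPolynomial.bind₁ (inverseApprox N k) (N i)

theorem inverseApprox_succ_eq (hN : N.IsTriangularFor h) (k : ℕ) :
    ∀ i, h i < k → N.inverseApprox (k + 1) i = N.inverseApprox k i := by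
  induction k with
  | zero => intro i hi; omega
  | succ k ih =>
    intro i hi
    refine congrArg (MvPolynomial.X i - ·) ?_
    refine MvPolynomial.eval₂Hom_congr' rfl (fun j hj _ => ih j ?_) rfl
    have := hN i j hj
    omega

theorem exists_rightInverse (hN : N.IsTriangularFor h) :
    ∃ G : RealPolyMap n, Function.RightInverse (toFun G) (toFun (idMap n + N)) := by
  let k := Finset.univ.sup h + 1
  refine ⟨N.inverseApprox k, fun y => ?_⟩
  ext i
  have hi : h i < k := Nat.lt_succ_of_le (Finset.le_sup (Finset.mem_univ i))
  have hG := congrArg (MvPolynomial.eval y) (hN.inverseApprox_succ_eq k i hi)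
  rw [inverseApprox, map_sub, MvPolynomial.eval_X, MvPolynomial.eval, MvPolynomial.eval₂Hom_bind₁]
    at hG
  rw [toFun_idMap_add]
  exact sub_eq_iff_eq_add.1 hG |>.symm

theorem isInvertible_idMap_add (hN : N.IsTriangularFor h) : (idMap n + N).IsInvertible := by
  obtain ⟨G, hG⟩ := hN.exists_rightInverse
  exact ⟨G, fun x => hN.injective_toFun_idMap_add (hG _), hG⟩

end IsTriangularFor

end RealPolyMap

theorem mainTheorem7 (n : ℕ) (N : RealPolyMap n) (hN : N.IsNilpotentMap) :
    (N.IsPositive → RealPolyMap.IsInvertible (RealPolyMap.idMap n + N)) ∧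
    (N.IsPositive ∨ N.IsNegative → N.HasAtMostOneFixedPoint) := by
  refine ⟨fun hpos => ?_, ?_⟩
  · obtain ⟨h, hh⟩ := hN.exists_isTriangularFor hpos
    exact hh.isInvertible_idMap_add
  · rintro (hpos | hneg)
    · obtain ⟨h, hh⟩ := hN.exists_isTriangularFor hpos
      exact hh.hasAtMostOneFixedPoint
    · obtain ⟨h, hh⟩ := hN.neg.exists_isTriangularFor hneg.neg
      exact hh.of_neg.hasAtMostOneFixedPoint
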